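/- Let $\delta_R,\delta_B\ge 1$ be integers. For $\lambda\in\mathbb C$ let $\omega=\sqrt\lambda$ and put $c=\cos\omega$, $s=\sin(\omega)/\omega$ (with $s=1$ at $\lambda=0$), $c'=-\omega\sin\omega$, $s'=\cos\omega$; these do not depend on the choice of the square root. Let $$M_0(\lambda)=\begin{pmatrix}c&s\\c'&s'\end{pmatrix},\quad M_1(\lambda)=M_0(\lambda)^{-1}=\begin{pmatrix}s'&-s\\-c'&c\end{pmatrix},\quad J_R=\begin{pmatrix}1&0\\0&1/\delta_R\end{pmatrix},\quad J_B=\begin{pmatrix}1&0\\0&1/\delta_B\end{pmatrix},$$ and let $T_0=J_RM_0J_BM_0$, $T_1=J_BM_1J_RM_1$ be the transfer matrices of the biregular tree with vertex degrees $\delta_R+1$ and $\delta_B+1$ and edges of length $1$. They have the same trace and the determinant $1/(\delta_R\delta_B)$, hence the same eigenvalues. Let $\sigma_1$ be the set of $\lambda\in\mathbb C$ for which all eigenvalues of $T_j(\lambda)$ have modulus $1/\sqrt{\delta_R\delta_B}$, and let $Z=\{\lambda\in\mathbb C : (\operatorname{tr}T_j(\lambda))^2=4/(\delta_R\delta_B)\}$.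 Then $\sigma_1\subset[0,\infty)$, the set $Z$ is closed and discrete, and there are single-valued analytic functions $\mu^+,\mu^-$ on $\mathbb C\setminus\sigma_1$ such that the following hold. 1. For every $\lambda\notin\sigma_1$ the set of eigenvalues of $T_j(\lambda)$ is $\{\mu^+(\lambda),\mu^-(\lambda)\}$ for $j=0,1$, and $|\mu^+(\lambda)|>1/\sqrt{\delta_R\delta_B}>|\mu^-(\lambda)|$. 2. As $\lambda\to-\infty$ along the real axis, $$e^{-2|\operatorname{Im}\sqrt\lambda|}\mu^+(\lambda)\to\frac{\delta_R+1}{2\delta_R}\,\frac{\delta_B+1}{2\delta_B},\qquad e^{2|\operatorname{Im}\sqrt\lambda|}\mu^-(\lambda)\to\frac{2}{\delta_R+1}\,\frac{2}{\delta_B+1}.$$ 3. The restrictions of $\mu^\pm$ to the open upper and to the open lower half plane have continuous extensions $\mu^\pm_{\uparrow}$ and $\mu^\pm_{\downarrow}$ to the respective closed half planes. At every real point outside $Z$ each of these extensions is analytic, that is, near that point it is the restriction of a function analytic in a full neighbourhood. For real $x$ the set of eigenvalues of $T_j(x)$ is $\{\mu^+_\uparrow(x),\mu^-_\uparrow(x)\}=\{\mu^+_\downarrow(x),\mu^-_\downarrow(x)\}$.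 4. For every $\nu\in\sigma_1$, writing $\mu^\pm(\nu)=\mu^\pm_\uparrow(\nu)$ for the boundary value from the upper half plane, $$\lim_{\epsilon\to0^+}\bigl(\mu^\pm(\nu+i\epsilon)-\mu^\pm(\nu-i\epsilon)\bigr)=2i\operatorname{Im}\mu^\pm(\nu).$$ The two sheets are interchanged: $\mu^\pm_\downarrow(\nu)=\mu^\mp_\uparrow(\nu)$, and if moreover $\nu\notin Z$, then some function analytic in a neighbourhood of $\nu$ agrees near $\nu$ with $\mu^\pm$ in the upper and with $\mu^\mp$ in the lower half plane. -/

import Mathlib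

open Filter Topology

noncomputable section

namespace BiregularTree

/-- A square root `ω` of `z`, nonnegative for `z ≥ 0` and equal to `i √|z|` for `z < 0`.
It enters below only through even functions of `ω`, so the choice of the branch is irrelevant. -/
def omega (z : ℂ) : ℂ := Complex.sqrt z

/-- `c(z) = cos ω`. -/
def c (z : ℂ) : ℂ := Complex.cos (omega z)

/-- `s(z) = sin ω / ω`, with the limit value `1` at `z = 0`. -/
def s (z : ℂ) : ℂ := if z = 0 then 1 else Complex.sin (omega z) / omega z

/-- `c'(z) = - ω sin ω`, the value at `x = 1` of the `x`-derivative of `cos (ω x)`. -/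
def c' (z : ℂ) : ℂ := -omega z * Complex.sin (omega z)

/-- `s'(z) = cos ω`, the value at `x = 1` of the `x`-derivative of `sin (ω x) / ω`. -/
def s' (z : ℂ) : ℂ := Complex.cos (omega z)

/-- Propagation of the data `(y, y')` of a solution of `-y'' = z y` from `x = 0` to `x = 1`. -/
def M0 (z : ℂ) : Matrix (Fin 2) (Fin 2) ℂ := !![c z, s z; c' z, s' z]

/-- Propagation of the data `(y, y')` of a solution of `-y'' = z y` from `x = 1` to `x = 0`. -/
def M1 (z : ℂ) : Matrix (Fin 2) (Fin 2) ℂ := !![s' z, -s z; -c' z, c z]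

/-- The jump of the data `(y, y')` across a vertex of degree `δ + 1`: `y` is continuous and the
derivative is divided by `δ`. -/
def J (δ : ℕ) : Matrix (Fin 2) (Fin 2) ℂ := !![1, 0; 0, 1 / (δ : ℂ)]

/-- The transfer matrices `T₀` (increasing `x`) and `T₁` (decreasing `x`) of the biregular tree
with vertex degrees `δR + 1` and `δB + 1`. -/
def T (δR δB : ℕ) : Fin 2 → ℂ → Matrix (Fin 2) (Fin 2) ℂ
  | 0, z => J δR * M0 z * J δB * M0 z
  | 1, z => J δB * M1 z * J δR * M1 z

/-- The two transfer matrices have the same trace. -/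
theorem trace_T_one (δR δB : ℕ) (z : ℂ) :
    (T δR δB 1 z).trace = (T δR δB 0 z).trace := by
  simp [T, J, M0, M1, Matrix.trace_fin_two, c, s']
  ring

/-- The set `σ₁` of all `z` such that all eigenvalues of the transfer matrices at `z` have
modulus `1 / √(δR δB)`. -/
def sigma1 (δR δB : ℕ) : Set ℂ :=
  {z | ∀ j : Fin 2, ∀ m ∈ spectrum ℂ (T δR δB j z), ‖m‖ = 1 / √((δR : ℝ) * δB)}

/-- The set where `tr(T_j)² = 4 / (δR δB)`, for one or equivalently for both `j`. -/
def discZeros (δR δB : ℕ) : Set ℂ :=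
  {z | (T δR δB 0 z).trace ^ 2 = 4 / ((δR : ℂ) * δB)}

/-- The open upper half plane, as a set. -/
def upper : Set ℂ := {z | 0 < z.im}

/-- The open lower half plane, as a set. -/
def lower : Set ℂ := {z | z.im < 0}

/-- `F` is a continuous extension of `f` from the open set `H` to the closure of `H`, which is
analytic at every boundary point outside `E`, in the sense that near such a point it is the
restriction of a function analytic in a full neighbourhood. -/
structure IsBoundaryExtension (H E : Set ℂ) (f F : ℂ → ℂ) : Prop where
  eqOn : Set.EqOn F f H
  continuousOn : ContinuousOn F (closure H)
  analytic : ∀ p ∈ frontier H, p ∉ E →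
    ∃ g : ℂ → ℂ, AnalyticAt ℂ g p ∧ ∀ᶠ z in 𝓝 p, z ∈ closure H → F z = g z

/-- Near `p`, one analytic function equals `f` in the upper and `h` in the lower half plane. -/
def ContinuesAcross (f h : ℂ → ℂ) (p : ℂ) : Prop :=
  ∃ g : ℂ → ℂ, AnalyticAt ℂ g p ∧ (∀ᶠ z in 𝓝 p, z ∈ upper → f z = g z) ∧
    ∀ᶠ z in 𝓝 p, z ∈ lower → h z = g z

end BiregularTree

end

open Filter Topology

namespace BiregularTree

/-! Multiplied by `√(δR δB)`, the two eigenvalues become reciprocal numbers `w`, `1/w` with sum `τ`,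
the normalized trace. Everything thus reduces to inverting the Joukowski map `w ↦ w + 1/w` at
`τ(λ)`. Since `M0` has determinant 1 and equal diagonal entries, `τ` is affine in `cos² ω`, hence
entire in `λ`.

The roots have modulus 1 exactly when `τ ∈ [-2, 2]`, so `σ₁` is the preimage of this segment
(`mem_sigma1_iff`). Off the segment the roots `t (1 ± √(1 - 4/t²)) / 2` are analytic and separated
by modulus. Over the open segment two other branches are analytic, `(t ± i √(4 - t²)) / 2`,
separated by the sign of the imaginary part. As `Im (w + 1/w)` has the sign of `Im w · (|w| - 1)`,
the outer root is the upper one for `Im t > 0` and the lower one for `Im t < 0`.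

By the arithmetic-geometric mean inequality, `τ ∈ [-2, 2]` forces `cos² ω ∈ [0, 1]`, so `ω` is real
and `λ ≥ 0`. At a point of `σ₁` outside `Z`, `sin 2ω ≠ 0`, and `Im τ` changes sign with `Im λ`
(`im_normTrace_sign`); hence the sheets are interchanged (`exists_analytic_branches`). At points of
`Z` both roots have the same limit. On `σ₁` the eigenvalues are complex conjugates, which gives the
jump. The asymptotics follow from `outerRoot t ~ t` for large `t`. -/

/-! ### Branches of the inverse Joukowski map -/

/-- The root of larger modulus of `w² - t w + 1`, for `t` outside `[-2, 2]`. -/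
noncomputable def outerRoot (t : ℂ) : ℂ := t * (1 + Complex.sqrt (1 - 4 / t ^ 2)) / 2

/-- The root of smaller modulus of `w² - t w + 1`, for `t` outside `[-2, 2]`. -/
noncomputable def innerRoot (t : ℂ) : ℂ := t * (1 - Complex.sqrt (1 - 4 / t ^ 2)) / 2

/-- The root of positive imaginary part of `w² - t w + 1`, for `t` in the plane slit along
`(-∞, -2]` and `[2, ∞)`. -/
noncomputable def upperRoot (t : ℂ) : ℂ := (t + Complex.I * Complex.sqrt (4 - t ^ 2)) / 2

/-- The root of negative imaginary part of `w² - t w + 1`, for `t` in the plane slit along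
`(-∞, -2]` and `[2, ∞)`. -/
noncomputable def lowerRoot (t : ℂ) : ℂ := (t - Complex.I * Complex.sqrt (4 - t ^ 2)) / 2

/-- The real segment `[-2, 2]` in the complex plane. -/
def traceSegment : Set ℂ := {t | t.im = 0 ∧ |t.re| ≤ 2}

theorem csqrt_sq (z : ℂ) : Complex.sqrt z ^ 2 = z := by
  simp [Complex.sqrt]

theorem csqrt_re_pos {z : ℂ} (hz : z ∈ Complex.slitPlane) : 0 < (Complex.sqrt z).re := by
  rw [Complex.sqrt, Complex.cpow_inv_two_re]
  apply Real.sqrt_pos.2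
  rcases hz with h | h
  · have := norm_nonneg z
    linarith
  · have h1 : |z.re| < ‖z‖ := Complex.abs_re_lt_norm.2 h
    have := neg_abs_le z.re
    linarith

theorem analyticAt_csqrt {z : ℂ} (hz : z ∈ Complex.slitPlane) : AnalyticAt ℂ Complex.sqrt z := by
  unfold Complex.sqrt
  exact AnalyticAt.cpow analyticAt_id analyticAt_const hz

theorem outerRoot_add_innerRoot (t : ℂ) : outerRoot t + innerRoot t = t := by
  unfold outerRoot innerRoot; ring

theorem ne_zero_of_notMem_segment {t : ℂ} (ht : t ∉ traceSegment) : t ≠ 0 := by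
  rintro rfl; exact ht (by simp [traceSegment])

theorem outerRoot_mul_innerRoot {t : ℂ} (ht : t ∉ traceSegment) : outerRoot t * innerRoot t = 1 := by
  have h0 := ne_zero_of_notMem_segment ht
  have h := csqrt_sq (1 - 4 / t ^ 2)
  calc outerRoot t * innerRoot t = t ^ 2 * (1 - Complex.sqrt (1 - 4 / t ^ 2) ^ 2) / 4 := by
        unfold outerRoot innerRoot; ring
    _ = 1 := by rw [h]; field_simp; ring

theorem mem_segment_of_sq {t : ℂ} {x : ℝ} (h0 : 0 ≤ x) (h4 : x ≤ 4) (h : t ^ 2 = x) :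
    t ∈ traceSegment := by
  have hre := congrArg Complex.re h
  have him := congrArg Complex.im h
  simp only [pow_two, Complex.mul_re, Complex.mul_im, Complex.ofReal_re, Complex.ofReal_im]
    at hre him
  have h1 : t.re * t.im = 0 := by linarith
  have h2 : t.im = 0 := by
    rcases mul_eq_zero.1 h1 with h2 | h2
    · rw [h2] at hre; nlinarith [sq_nonneg t.im]
    · exact h2
  refine ⟨h2, abs_le_of_sq_le_sq ?_ (by norm_num)⟩
  rw [h2] at hre; nlinarith

/-- If `1 - 4/t²` were on the cut, then `4/t² = y` with `y ≥ 1` real, so `t² = 4/y ∈ (0, 4]` and `t`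
is in the segment. The form `t √(1 - 4/t²)` is preferred to `√(t² - 4)`, whose principal branch is
also cut along the imaginary axis. -/
theorem one_sub_mem_slitPlane {t : ℂ} (ht : t ∉ traceSegment) :
    1 - 4 / t ^ 2 ∈ Complex.slitPlane := by
  have h0 := ne_zero_of_notMem_segment ht
  by_contra hn
  rw [Complex.mem_slitPlane_iff_not_le_zero, not_not] at hn
  obtain ⟨y, hy⟩ : ∃ y : ℝ, 4 / t ^ 2 = (y : ℂ) ∧ 1 ≤ y := by
    refine ⟨(4 / t ^ 2).re, ?_, ?_⟩
    · apply Complex.ext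
      · simp
      · have := (Complex.le_def.1 hn).2
        simp only [Complex.sub_im, Complex.one_im, Complex.zero_im] at this
        simp only [Complex.ofReal_im]; linarith
    · have := (Complex.le_def.1 hn).1
      simp only [Complex.sub_re, Complex.one_re, Complex.zero_re] at this
      linarith
  have hy0 : (y : ℂ) ≠ 0 := by exact_mod_cast (by linarith [hy.2] : y ≠ 0)
  refine ht (mem_segment_of_sq (x := 4 / y) ?_ ?_ ?_)
  · have := hy.2; positivity
  · have := hy.2; rw [div_le_iff₀ (by linarith)]; linarith
  · push_cast; rw [← hy.1]; field_simp

theorem norm_innerRoot_lt_norm_outerRoot {t : ℂ} (ht : t ∉ traceSegment) :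
    ‖innerRoot t‖ < ‖outerRoot t‖ := by
  have h0 := norm_pos_iff.2 (ne_zero_of_notMem_segment ht)
  have hr := csqrt_re_pos (one_sub_mem_slitPlane ht)
  set v := Complex.sqrt (1 - 4 / t ^ 2) with hv
  -- The squared moduli differ by `4 Re v`, and the principal root has `Re v > 0` off the cut.
  have key : ‖1 - v‖ < ‖1 + v‖ := by
    apply lt_of_pow_lt_pow_left₀ 2 (norm_nonneg _)
    rw [← Complex.normSq_eq_norm_sq, ← Complex.normSq_eq_norm_sq, Complex.normSq_apply,
      Complex.normSq_apply]
    simp only [Complex.sub_re, Complex.sub_im, Complex.add_re, Complex.add_im, Complex.one_re,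
      Complex.one_im]
    nlinarith
  unfold innerRoot outerRoot
  rw [norm_div, norm_div, norm_mul, norm_mul, ← hv]
  gcongr
  simp

theorem norm_outerRoot_mul {t : ℂ} (ht : t ∉ traceSegment) : ‖outerRoot t‖ * ‖innerRoot t‖ = 1 := by
  rw [← norm_mul, outerRoot_mul_innerRoot ht, norm_one]

theorem one_lt_norm_outerRoot {t : ℂ} (ht : t ∉ traceSegment) : 1 < ‖outerRoot t‖ := by
  have h1 := norm_innerRoot_lt_norm_outerRoot ht
  have h2 := norm_outerRoot_mul ht
  nlinarith [norm_nonneg (innerRoot t), norm_nonneg (outerRoot t)]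

theorem norm_innerRoot_lt_one {t : ℂ} (ht : t ∉ traceSegment) : ‖innerRoot t‖ < 1 := by
  have h1 := norm_innerRoot_lt_norm_outerRoot ht
  have h2 := norm_outerRoot_mul ht
  nlinarith [norm_nonneg (innerRoot t), norm_nonneg (outerRoot t)]

theorem analyticAt_outerRoot {t : ℂ} (ht : t ∉ traceSegment) : AnalyticAt ℂ outerRoot t := by
  have h0 := ne_zero_of_notMem_segment ht
  have h1 : AnalyticAt ℂ (fun t : ℂ => 1 - 4 / t ^ 2) t :=
    analyticAt_const.sub (analyticAt_const.div (analyticAt_id.pow 2) (pow_ne_zero 2 h0))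
  have h2 : AnalyticAt ℂ (fun t : ℂ => Complex.sqrt (1 - 4 / t ^ 2)) t :=
    AnalyticAt.fun_comp (analyticAt_csqrt (one_sub_mem_slitPlane ht)) h1
  exact (analyticAt_id.mul (analyticAt_const.add h2)).div_const

theorem analyticAt_innerRoot {t : ℂ} (ht : t ∉ traceSegment) : AnalyticAt ℂ innerRoot t := by
  have h : innerRoot = fun t => t - outerRoot t := by
    funext t; rw [eq_sub_iff_add_eq, add_comm, outerRoot_add_innerRoot]
  rw [h]
  exact analyticAt_id.sub (analyticAt_outerRoot ht)

theorem upperRoot_add_lowerRoot (t : ℂ) : upperRoot t + lowerRoot t = t := by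
  unfold upperRoot lowerRoot; ring

theorem upperRoot_mul_lowerRoot (t : ℂ) : upperRoot t * lowerRoot t = 1 := by
  have h := csqrt_sq (4 - t ^ 2)
  calc upperRoot t * lowerRoot t
      = (t ^ 2 - Complex.I ^ 2 * Complex.sqrt (4 - t ^ 2) ^ 2) / 4 := by
        unfold upperRoot lowerRoot; ring
    _ = 1 := by rw [h, Complex.I_sq]; ring

theorem four_sub_sq_mem_slitPlane {t : ℂ} (ht : t.im ≠ 0 ∨ |t.re| < 2) :
    4 - t ^ 2 ∈ Complex.slitPlane := by
  rw [Complex.mem_slitPlane_iff]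
  simp only [pow_two, Complex.sub_re, Complex.sub_im, Complex.mul_re, Complex.mul_im,
    Complex.re_ofNat, Complex.im_ofNat]
  by_cases him : t.im = 0
  · left
    have h := ht.resolve_left (not_not.2 him)
    rw [him]
    have := abs_lt.1 h
    nlinarith
  · by_cases hre : t.re = 0
    · left
      rw [hre]; nlinarith [sq_nonneg t.im]
    · right
      have : t.re * t.im ≠ 0 := mul_ne_zero hre him
      intro h; apply this; linarith

theorem analyticAt_upperRoot {t : ℂ} (ht : t.im ≠ 0 ∨ |t.re| < 2) :
    AnalyticAt ℂ upperRoot t := by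
  have h1 : AnalyticAt ℂ (fun t : ℂ => 4 - t ^ 2) t := analyticAt_const.sub (analyticAt_id.pow 2)
  have h2 : AnalyticAt ℂ (fun t : ℂ => Complex.sqrt (4 - t ^ 2)) t :=
    AnalyticAt.fun_comp (analyticAt_csqrt (four_sub_sq_mem_slitPlane ht)) h1
  exact (analyticAt_id.add (analyticAt_const.mul h2)).div_const

theorem analyticAt_lowerRoot {t : ℂ} (ht : t.im ≠ 0 ∨ |t.re| < 2) :
    AnalyticAt ℂ lowerRoot t := by
  have h : lowerRoot = fun t => t - upperRoot t := by
    funext t; rw [eq_sub_iff_add_eq, add_comm, upperRoot_add_lowerRoot]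
  rw [h]
  exact analyticAt_id.sub (analyticAt_upperRoot ht)

theorem eq_conj_div_normSq {v w : ℂ} (h : w * v = 1) : v = (starRingEnd ℂ w) / Complex.normSq w := by
  rw [← one_div_one_div v, ← eq_one_div_of_mul_eq_one_left h, one_div, Complex.inv_def]
  push_cast
  rfl

/-- The two roots are reciprocal, so their imaginary parts have opposite signs; the difference of
these parts is `Re √(4 - t²) > 0`. -/
theorem upperRoot_im_pos {t : ℂ} (ht : t.im ≠ 0 ∨ |t.re| < 2) : 0 < (upperRoot t).im := by
  have hr := csqrt_re_pos (four_sub_sq_mem_slitPlane ht)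
  have hm := upperRoot_mul_lowerRoot t
  have hw : upperRoot t ≠ 0 := left_ne_zero_of_mul_eq_one hm
  have hn : 0 < Complex.normSq (upperRoot t) := Complex.normSq_pos.2 hw
  have hd : (upperRoot t).im - (lowerRoot t).im = (Complex.sqrt (4 - t ^ 2)).re := by
    rw [← Complex.sub_im]
    have : upperRoot t - lowerRoot t = Complex.I * Complex.sqrt (4 - t ^ 2) := by
      unfold upperRoot lowerRoot; ring
    rw [this]; simp
  have hl : (lowerRoot t).im = -(upperRoot t).im / Complex.normSq (upperRoot t) := by
    conv_lhs => rw [eq_conj_div_normSq hm]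
    rw [Complex.div_ofReal_im, Complex.conj_im]
  rw [hl] at hd
  have h2 : (upperRoot t).im * (1 + 1 / Complex.normSq (upperRoot t)) =
      (Complex.sqrt (4 - t ^ 2)).re := by
    rw [← hd]; ring
  rw [← h2] at hr
  exact (pos_iff_pos_of_mul_pos hr).2 (by positivity)

/-- This links the two ways of naming a root: the sign of `Im (w + 1/w)` is that of `Im w` times
that of `|w| - 1`. -/
theorem im_eq_of_mul_eq_one {v w : ℂ} (h : w * v = 1) :
    (w + v).im * Complex.normSq w = w.im * (Complex.normSq w - 1) := by
  have hn : Complex.normSq w ≠ 0 := fun h0 => by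
    rw [Complex.normSq_eq_zero.1 h0] at h; simp at h
  conv_lhs => rw [eq_conj_div_normSq h]
  rw [Complex.add_im, Complex.div_ofReal_im, Complex.conj_im]
  field_simp
  ring

theorem notMem_segment_of_im_ne_zero {t : ℂ} (ht : t.im ≠ 0) : t ∉ traceSegment := fun h => ht h.1

theorem eq_or_eq_of_add_of_mul {a b x y : ℂ} (h1 : a + b = x + y) (h2 : a * b = x * y) :
    a = x ∧ b = y ∨ a = y ∧ b = x := by
  have : (a - x) * (a - y) = 0 := by linear_combination a * h1 - h2
  rcases mul_eq_zero.1 this with h | h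
  · left
    exact ⟨sub_eq_zero.1 h, by linear_combination h1 - h⟩
  · right
    exact ⟨sub_eq_zero.1 h, by linear_combination h1 - h⟩

theorem roots_of_im_pos {t : ℂ} (ht : 0 < t.im) :
    outerRoot t = upperRoot t ∧ innerRoot t = lowerRoot t := by
  have hs := notMem_segment_of_im_ne_zero ht.ne'
  have hu := upperRoot_im_pos (Or.inl ht.ne')
  have him := im_eq_of_mul_eq_one (upperRoot_mul_lowerRoot t)
  rw [upperRoot_add_lowerRoot] at him
  rcases eq_or_eq_of_add_of_mul
    ((outerRoot_add_innerRoot t).trans (upperRoot_add_lowerRoot t).symm)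
    ((outerRoot_mul_innerRoot hs).trans (upperRoot_mul_lowerRoot t).symm) with h | h
  · exact h
  · exfalso
    have h1 := norm_innerRoot_lt_one hs
    rw [h.2] at h1
    have h3 : Complex.normSq (upperRoot t) < 1 := by
      rw [Complex.normSq_eq_norm_sq]; nlinarith [norm_nonneg (upperRoot t)]
    have h4 := Complex.normSq_nonneg (upperRoot t)
    nlinarith [mul_nonneg ht.le h4, mul_pos hu (sub_pos.2 h3)]

theorem roots_of_im_neg {t : ℂ} (ht : t.im < 0) :
    outerRoot t = lowerRoot t ∧ innerRoot t = upperRoot t := by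
  have hs := notMem_segment_of_im_ne_zero ht.ne
  have hu := upperRoot_im_pos (Or.inl ht.ne)
  have him := im_eq_of_mul_eq_one (upperRoot_mul_lowerRoot t)
  rw [upperRoot_add_lowerRoot] at him
  rcases eq_or_eq_of_add_of_mul
    ((outerRoot_add_innerRoot t).trans (upperRoot_add_lowerRoot t).symm)
    ((outerRoot_mul_innerRoot hs).trans (upperRoot_mul_lowerRoot t).symm) with h | h
  · exfalso
    have h1 := one_lt_norm_outerRoot hs
    rw [h.1] at h1
    have h3 : 1 < Complex.normSq (upperRoot t) := by
      rw [Complex.normSq_eq_norm_sq]; nlinarith [norm_nonneg (upperRoot t)]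
    nlinarith [mul_pos hu (sub_pos.2 h3)]
  · exact h

/-- The roots of `w² - t w + 1` tend to `e = ±1` as `t` tends to `2 e`. -/
theorem tendsto_root {ι : Type*} {l : Filter ι} {w t : ι → ℂ} {e : ℂ} (he : e ^ 2 = 1)
    (ht : Tendsto t l (𝓝 (2 * e))) (h : ∀ᶠ i in l, w i ^ 2 - t i * w i + 1 = 0) :
    Tendsto w l (𝓝 e) := by
  have h1 : Tendsto (fun i => (‖t i‖ + 1) * ‖t i - 2 * e‖) l (𝓝 0) := by
    have := (ht.norm.add_const 1).mul (ht.sub_const (2 * e)).norm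
    simpa using this
  have hb : ∀ᶠ i in l, ‖(w i - e) ^ 2‖ ≤ (‖t i‖ + 1) * ‖t i - 2 * e‖ := by
    filter_upwards [h] with i hi
    -- Near the double root the equation gives only square-root control: `(w - e)² = w (t - 2e)`,
    -- where `w` stays bounded.
    have h2 : (w i - e) ^ 2 = w i * (t i - 2 * e) := by linear_combination hi + he
    rw [h2, norm_mul]
    gcongr
    -- If `|w| > |t| + 1`, then both factors of `w (w - t) = -1` have modulus above 1.
    by_contra! hc
    have h3 : w i * (w i - t i) = -1 := by linear_combination hi
    have h4 : ‖w i‖ * ‖w i - t i‖ = 1 := by rw [← norm_mul, h3]; simp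
    have h5 : ‖w i‖ - ‖t i‖ ≤ ‖w i - t i‖ := norm_sub_norm_le _ _
    nlinarith [norm_nonneg (t i)]
  have h6 : Tendsto (fun i => (w i - e) ^ 2) l (𝓝 0) := squeeze_zero_norm' hb h1
  have h7 : Tendsto (fun i => √‖(w i - e) ^ 2‖) l (𝓝 0) := by
    have := (Real.continuous_sqrt.tendsto 0).comp (by simpa using h6.norm)
    simpa [Function.comp_def] using this
  rw [tendsto_iff_norm_sub_tendsto_zero]
  simpa [norm_pow] using h7

/-! ### The entire function `cos √z` -/

theorem omega_sq (z : ℂ) : omega z ^ 2 = z := csqrt_sq z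

theorem c_eq_cos {z w : ℂ} (h : w ^ 2 = z) : c z = Complex.cos w := by
  have h1 : omega z ^ 2 = w ^ 2 := by rw [omega_sq, h]
  rcases sq_eq_sq_iff_eq_or_eq_neg.1 h1 with h2 | h2 <;> simp [c, h2]

/-- Cosine is even, so near the cut of the principal root `√z` may be replaced by `i √(-z)`. At the
origin continuity suffices, by removability of singularities. -/
theorem differentiable_c : Differentiable ℂ c := by
  have hpos : ∀ z ∈ Complex.slitPlane, DifferentiableAt ℂ c z := fun z hz =>
    (Complex.differentiable_cos _).comp z (Complex.differentiableAt_sqrt hz)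
  have hne : ∀ z : ℂ, z ≠ 0 → DifferentiableAt ℂ c z := by
    intro z hz
    rcases Complex.mem_slitPlane_or_neg_mem_slitPlane hz with h | h
    · exact hpos z h
    · have h1 : c = fun z => Complex.cos (Complex.I * Complex.sqrt (-z)) := by
        funext z
        apply c_eq_cos
        rw [mul_pow, csqrt_sq, Complex.I_sq]; ring
      rw [h1]
      have h2 : DifferentiableAt ℂ (fun z : ℂ => Complex.sqrt (-z)) z :=
        DifferentiableAt.comp z (g := Complex.sqrt) (Complex.differentiableAt_sqrt h)
          differentiableAt_id.neg
      exact (h2.const_mul Complex.I).ccos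
  intro z
  by_cases hz : z = 0
  · subst hz
    refine (Complex.analyticAt_of_differentiable_on_punctured_nhds_of_continuousAt
      ?_ ?_).differentiableAt
    · filter_upwards [self_mem_nhdsWithin] with z hz
      exact hne z hz
    · exact Complex.continuous_cos.continuousAt.comp
        (Complex.continuousAt_sqrt (Or.inl le_rfl))
  · exact hne z hz

/-- This is `det M0 = 1`, the constancy of the Wronskian; it also eliminates `s` and `c'` from the
trace. -/
theorem s_mul_c' (z : ℂ) : s z * c' z = c z ^ 2 - 1 := by
  have h := Complex.sin_sq_add_cos_sq (omega z)
  by_cases hz : z = 0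
  · subst hz
    simp [s, c', c, omega]
  · have h0 : omega z ≠ 0 := fun h0 => hz (by rw [← omega_sq z, h0]; simp)
    simp only [s, c', c, if_neg hz]
    field_simp
    linear_combination -h

/-! ### Trace, determinant and spectrum of the transfer matrices -/

section

variable (δR δB : ℕ)

theorem det_T (hR : 1 ≤ δR) (hB : 1 ≤ δB) (j : Fin 2) (z : ℂ) :
    (T δR δB j z).det = 1 / ((δR : ℂ) * δB) := by
  have h := s_mul_c' z
  have hR' : (δR : ℂ) ≠ 0 := by exact_mod_cast (by omega : δR ≠ 0)
  have hB' : (δB : ℂ) ≠ 0 := by exact_mod_cast (by omega : δB ≠ 0)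
  have h0 : (M0 z).det = 1 := by
    simp only [M0, Matrix.det_fin_two_of]
    change c z * c z - _ = 1
    linear_combination -h
  have h1 : (M1 z).det = 1 := by
    simp only [M1, Matrix.det_fin_two_of]
    change c z * c z - _ = 1
    linear_combination -h
  fin_cases j
  · simp only [T, Matrix.det_mul, h0, J, Matrix.det_fin_two_of]
    field_simp; ring
  · simp only [T, Matrix.det_mul, h1, J, Matrix.det_fin_two_of]
    field_simp; ring

theorem trace_T (hR : 1 ≤ δR) (hB : 1 ≤ δB) (j : Fin 2) (z : ℂ) :
    (T δR δB j z).trace =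
      ((δR + 1) * (δB + 1) * c z ^ 2 - (δR + δB)) / ((δR : ℂ) * δB) := by
  have hR' : (δR : ℂ) ≠ 0 := by exact_mod_cast (by omega : δR ≠ 0)
  have hB' : (δB : ℂ) ≠ 0 := by exact_mod_cast (by omega : δB ≠ 0)
  have h0 : (T δR δB 0 z).trace =
      ((δR + 1) * (δB + 1) * c z ^ 2 - (δR + δB)) / ((δR : ℂ) * δB) := by
    have h := s_mul_c' z
    have hs : s' z = c z := rfl
    simp only [T, J, M0, Matrix.trace_fin_two, Matrix.mul_apply, Fin.sum_univ_two, hs]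
    simp
    field_simp
    linear_combination ((δR : ℂ) + δB) * h
  fin_cases j
  · exact h0
  · exact (trace_T_one δR δB z).trans h0

/-- The trace of the transfer matrices, normalized so that the product of the eigenvalues becomes
`1`. -/
noncomputable def normTrace (z : ℂ) : ℂ := (√((δR : ℝ) * δB) : ℂ) * (T δR δB 0 z).trace

variable {δR δB}

theorem sqrt_pos (hR : 1 ≤ δR) (hB : 1 ≤ δB) : 0 < √((δR : ℝ) * δB) := by
  have hR' : (0 : ℝ) < δR := by exact_mod_cast hR
  have hB' : (0 : ℝ) < δB := by exact_mod_cast hB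
  positivity

theorem sqrt_ne_zero (hR : 1 ≤ δR) (hB : 1 ≤ δB) : (√((δR : ℝ) * δB) : ℂ) ≠ 0 :=
  Complex.ofReal_ne_zero.2 (sqrt_pos hR hB).ne'

variable (δR δB) in
theorem sqrt_sq_complex : (√((δR : ℝ) * δB) : ℂ) ^ 2 = (δR : ℂ) * δB := by
  rw [← Complex.ofReal_pow, Real.sq_sqrt (by positivity)]; push_cast; rfl

theorem normTrace_eq (hR : 1 ≤ δR) (hB : 1 ≤ δB) (z : ℂ) :
    normTrace δR δB z =
      ((δR + 1) * (δB + 1) * c z ^ 2 - (δR + δB)) / (√((δR : ℝ) * δB) : ℂ) := by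
  have h := sqrt_ne_zero hR hB
  have h2 := sqrt_sq_complex δR δB
  rw [normTrace, trace_T δR δB hR hB, ← h2]
  field_simp

theorem differentiable_normTrace (hR : 1 ≤ δR) (hB : 1 ≤ δB) :
    Differentiable ℂ (normTrace δR δB) := by
  rw [funext (normTrace_eq hR hB)]
  exact (((differentiable_c.pow 2).const_mul _).sub_const _).div_const _

theorem spectrum_fin_two {A : Matrix (Fin 2) (Fin 2) ℂ} {a b : ℂ} (h1 : a + b = A.trace)
    (h2 : a * b = A.det) : spectrum ℂ A = {a, b} := by
  ext m
  rw [Matrix.mem_spectrum_iff_isRoot_charpoly, Matrix.charpoly_fin_two, Polynomial.IsRoot.def,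
    ← h1, ← h2]
  simp only [Polynomial.eval_add, Polynomial.eval_sub, Polynomial.eval_pow, Polynomial.eval_X,
    Polynomial.eval_mul, Polynomial.eval_C, Set.mem_insert_iff, Set.mem_singleton_iff]
  rw [← sub_eq_zero (a := m) (b := a), ← sub_eq_zero (a := m) (b := b), ← mul_eq_zero]
  constructor <;> intro h <;> linear_combination h

theorem spectrum_T (hR : 1 ≤ δR) (hB : 1 ≤ δB) (j : Fin 2) {z a b : ℂ}
    (h1 : a + b = normTrace δR δB z) (h2 : a * b = 1) :
    spectrum ℂ (T δR δB j z) =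
      {a / (√((δR : ℝ) * δB) : ℂ), b / (√((δR : ℝ) * δB) : ℂ)} := by
  have h := sqrt_ne_zero hR hB
  have h3 := sqrt_sq_complex δR δB
  apply spectrum_fin_two
  · rw [← add_div, h1, normTrace, trace_T δR δB hR hB, trace_T δR δB hR hB]
    field_simp
  · rw [det_T δR δB hR hB, div_mul_div_comm, h2, ← pow_two, h3]

/-! ### The set `σ₁` as the preimage of the segment -/

theorem norm_root_of_mem_segment {t : ℂ} (ht : t ∈ traceSegment) :
    ‖upperRoot t‖ = 1 ∧ ‖lowerRoot t‖ = 1 := by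
  obtain ⟨h1, h2⟩ := ht
  obtain ⟨x, rfl⟩ : ∃ x : ℝ, t = x := ⟨t.re, Complex.ext rfl (by simpa using h1)⟩
  simp only [Complex.ofReal_re] at h2
  have hx : 0 ≤ 4 - x ^ 2 := by nlinarith [abs_le.1 h2, sq_abs x, abs_nonneg x]
  have hu : ‖upperRoot (x : ℂ)‖ = 1 := by
    have hs : Complex.sqrt (4 - (x : ℂ) ^ 2) = (√(4 - x ^ 2) : ℝ) := by
      have := Complex.sqrt_of_nonneg (a := ((4 - x ^ 2 : ℝ) : ℂ)) (Complex.zero_le_real.2 hx)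
      rw [Complex.ofReal_re] at this
      rw [← this]; push_cast; rfl
    rw [← sq_eq_sq₀ (norm_nonneg _) zero_le_one, ← Complex.normSq_eq_norm_sq, upperRoot, hs,
      Complex.normSq_div, Complex.normSq_apply]
    simp
    rw [← pow_two, ← pow_two, Real.sq_sqrt hx]
    ring
  have h := congrArg norm (upperRoot_mul_lowerRoot (x : ℂ))
  rw [norm_mul, hu] at h
  exact ⟨hu, by simpa using h⟩

/-- A reciprocal on the unit circle is the conjugate, so the sum is `2 Re w`. -/
theorem mem_segment_of_norm_eq_one {w v : ℂ} (h : w * v = 1) (hw : ‖w‖ = 1) :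
    w + v ∈ traceSegment := by
  have hn : Complex.normSq w = 1 := by rw [Complex.normSq_eq_norm_sq, hw]; norm_num
  have hv := eq_conj_div_normSq h
  rw [hn, Complex.ofReal_one, div_one] at hv
  subst hv
  refine ⟨by simp, ?_⟩
  rw [Complex.add_re, Complex.conj_re, ← two_mul, abs_mul]
  have := Complex.abs_re_le_norm w
  rw [abs_two]; linarith

theorem mem_sigma1_iff (hR : 1 ≤ δR) (hB : 1 ≤ δB) {z : ℂ} :
    z ∈ sigma1 δR δB ↔ normTrace δR δB z ∈ traceSegment := by
  have hp := sqrt_pos hR hB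
  have hsp := fun j => spectrum_T (z := z) hR hB j (upperRoot_add_lowerRoot _)
    (upperRoot_mul_lowerRoot _)
  have hnorm : ∀ w : ℂ, ‖w / (√((δR : ℝ) * δB) : ℂ)‖ = 1 / √((δR : ℝ) * δB) ↔ ‖w‖ = 1 := by
    intro w
    rw [norm_div, Complex.norm_real, Real.norm_of_nonneg hp.le]
    field_simp
  simp only [sigma1, Set.mem_ofPred_eq, hsp, Set.mem_insert_iff, Set.mem_singleton_iff,
    forall_eq_or_imp, forall_eq, hnorm, forall_const]
  constructor
  · rintro ⟨h1, -⟩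
    have := mem_segment_of_norm_eq_one (upperRoot_mul_lowerRoot _) h1
    rwa [upperRoot_add_lowerRoot] at this
  · exact norm_root_of_mem_segment

theorem mem_discZeros_iff (hR : 1 ≤ δR) (hB : 1 ≤ δB) {z : ℂ} :
    z ∈ discZeros δR δB ↔ normTrace δR δB z ^ 2 = 4 := by
  have h3 := sqrt_sq_complex δR δB
  have h : (δR : ℂ) * δB ≠ 0 := by rw [← h3]; exact pow_ne_zero 2 (sqrt_ne_zero hR hB)
  rw [normTrace, mul_pow, h3, discZeros, Set.mem_ofPred_eq, eq_div_iff h, mul_comm]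

/-- On `σ₁` the number `cos² ω` is real and lies between `0` and `1`, strictly so off the zeros of
the discriminant. -/
theorem c_sq_of_mem_sigma1 (hR : 1 ≤ δR) (hB : 1 ≤ δB) {z : ℂ} (hz : z ∈ sigma1 δR δB) :
    ∃ y : ℝ, c z ^ 2 = y ∧ 0 ≤ y ∧ y ≤ 1 ∧ (z ∉ discZeros δR δB → 0 < y ∧ y < 1) := by
  have hp := sqrt_pos hR hB
  have hpc := sqrt_ne_zero hR hB
  have hsq : √((δR : ℝ) * δB) ^ 2 = (δR : ℝ) * δB := Real.sq_sqrt (by positivity)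
  obtain ⟨h1, h2⟩ := (mem_sigma1_iff hR hB).1 hz
  obtain ⟨x, hx⟩ : ∃ x : ℝ, normTrace δR δB z = x :=
    ⟨_, Complex.ext rfl (by simpa using h1)⟩
  rw [mem_discZeros_iff hR hB, hx]
  rw [hx, Complex.ofReal_re, abs_le] at h2
  rw [normTrace_eq hR hB, div_eq_iff hpc] at hx
  set p := √((δR : ℝ) * δB) with hpdef
  have hR' : (1 : ℝ) ≤ δR := by exact_mod_cast hR
  have hB' : (1 : ℝ) ≤ δB := by exact_mod_cast hB
  have hA : (0 : ℝ) < (δR + 1) * (δB + 1) := by positivity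
  have hAc : ((δR : ℂ) + 1) * (δB + 1) ≠ 0 := by exact_mod_cast hA.ne'
  -- With `p² = δR δB`, this bound yields `y ≥ 0` and the next one yields `y ≤ 1`, as `|x| ≤ 2`.
  have hb : 2 * p ≤ δR + δB := by
    apply le_of_sq_le_sq _ (by positivity)
    nlinarith [sq_nonneg ((δR : ℝ) - δB)]
  have hb' : 2 * p ≤ 1 + δR * δB := by nlinarith [sq_nonneg (p - 1)]
  refine ⟨(x * p + (δR + δB)) / ((δR + 1) * (δB + 1)), ?_, ?_, ?_, ?_⟩
  · push_cast
    rw [eq_div_iff hAc]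
    linear_combination hx
  · apply div_nonneg _ hA.le; nlinarith
  · rw [div_le_one hA]; nlinarith
  · intro h
    have hne : x ^ 2 ≠ 4 := by exact_mod_cast h
    have hl : -2 < x := lt_of_le_of_ne h2.1 (by rintro rfl; norm_num at hne)
    have hr : x < 2 := lt_of_le_of_ne h2.2 (by rintro rfl; norm_num at hne)
    constructor
    · apply div_pos _ hA; nlinarith
    · rw [div_lt_one hA]; nlinarith

/-! ### Location of `σ₁` and the sign of the imaginary part of the trace -/

theorem re_cos (w : ℂ) : (Complex.cos w).re = Real.cos w.re * Real.cosh w.im := by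
  conv_lhs => rw [← Complex.re_add_im w, Complex.cos_add_mul_I]
  simp [← Complex.ofReal_cos, ← Complex.ofReal_cosh, ← Complex.ofReal_sin, ← Complex.ofReal_sinh]

theorem im_cos (w : ℂ) : (Complex.cos w).im = -(Real.sin w.re * Real.sinh w.im) := by
  conv_lhs => rw [← Complex.re_add_im w, Complex.cos_add_mul_I]
  simp [← Complex.ofReal_cos, ← Complex.ofReal_cosh, ← Complex.ofReal_sin, ← Complex.ofReal_sinh]

theorem c_sq (z : ℂ) : c z ^ 2 = (1 + Complex.cos (2 * omega z)) / 2 := by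
  rw [c, Complex.cos_two_mul]; ring

/-- On `σ₁`, `cos 2ω` is real and lies in `[-1, 1]`. Its imaginary part vanishes only if `sinh (2 Im
ω) = 0` or `sin (2 Re ω) = 0`; in the second case `cosh (2 Im ω) ≤ 1`. Either way `ω` is real, and
`z = ω² ≥ 0`. -/
theorem sigma1_subset (hR : 1 ≤ δR) (hB : 1 ≤ δB) :
    sigma1 δR δB ⊆ {z : ℂ | 0 ≤ z.re ∧ z.im = 0} := by
  intro z hz
  obtain ⟨y, hy, h0, h1, -⟩ := c_sq_of_mem_sigma1 hR hB hz
  rw [c_sq] at hy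
  have hcos : Complex.cos (2 * omega z) = ((2 * y - 1 : ℝ) : ℂ) := by
    push_cast; linear_combination 2 * hy
  have hre := congrArg Complex.re hcos
  have him := congrArg Complex.im hcos
  rw [re_cos, Complex.ofReal_re] at hre
  rw [im_cos, Complex.ofReal_im, neg_eq_zero, mul_eq_zero] at him
  have hw : (2 * omega z).im = 0 := by
    rcases him with h | h
    · have hc2 : Real.cos (2 * omega z).re ^ 2 = 1 := by
        have := Real.sin_sq_add_cos_sq (2 * omega z).re
        rw [h] at this; linarith
      have hch : Real.cosh (2 * omega z).im ^ 2 ≤ 1 := by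
        have : (Real.cos (2 * omega z).re * Real.cosh (2 * omega z).im) ^ 2 ≤ 1 := by
          rw [hre]; nlinarith
        rwa [mul_pow, hc2, one_mul] at this
      have h3 := Real.cosh_sq (2 * omega z).im
      have : Real.sinh (2 * omega z).im ^ 2 = 0 := by
        nlinarith [sq_nonneg (Real.sinh (2 * omega z).im)]
      exact Real.sinh_eq_zero.1 (pow_eq_zero_iff two_ne_zero |>.1 this)
    · exact Real.sinh_eq_zero.1 h
  have hw' : (omega z).im = 0 := by simpa using hw
  rw [Set.mem_ofPred_eq, ← omega_sq z, pow_two, Complex.mul_re, Complex.mul_im, hw']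
  constructor
  · nlinarith [sq_nonneg (omega z).re]
  · ring

/-- Across a point of `σ₁` where the discriminant does not vanish, the imaginary part of the trace
changes sign together with the imaginary part of the spectral parameter. -/
theorem im_normTrace_sign (hR : 1 ≤ δR) (hB : 1 ≤ δB) {ν : ℝ} (hν : (ν : ℂ) ∈ sigma1 δR δB)
    (hZ : (ν : ℂ) ∉ discZeros δR δB) :
    ∃ e : ℝ, e ≠ 0 ∧ ∀ᶠ z in 𝓝 (ν : ℂ),
      (0 < z.im → 0 < e * (normTrace δR δB z).im) ∧
      (z.im < 0 → e * (normTrace δR δB z).im < 0) := by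
  obtain ⟨y, hy, -, -, hy1⟩ := c_sq_of_mem_sigma1 hR hB hν
  obtain ⟨h0, h1⟩ := hy1 hZ
  have hν0 : 0 < ν := by
    -- At the origin `cos² ω = 1`, which the strict bound `y < 1` excludes.
    refine lt_of_le_of_ne (by simpa using (sigma1_subset hR hB hν).1) ?_
    rintro rfl
    have : (1 : ℂ) = y := by rw [← hy]; simp [c, omega]
    exact h1.ne' (by exact_mod_cast this)
  have hslit : (ν : ℂ) ∈ Complex.slitPlane := Or.inl (by simpa using hν0)
  have hω : omega ν = (√ν : ℝ) := by
    rw [omega, Complex.sqrt_of_nonneg (Complex.zero_le_real.2 hν0.le), Complex.ofReal_re]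
  have hcos : Real.cos (2 * √ν) = 2 * y - 1 := by
    have h : Complex.cos (2 * omega ν) = ((2 * y - 1 : ℝ) : ℂ) := by
      rw [c_sq] at hy
      push_cast; linear_combination 2 * hy
    rw [hω] at h
    exact_mod_cast h
  set e := Real.sin (2 * √ν) with he
  have hene : e ≠ 0 := by
    intro h
    have := Real.sin_sq_add_cos_sq (2 * √ν)
    rw [← he, h, hcos] at this
    nlinarith
  -- With `ω = α + iβ`, `Im τ = -K sin 2α sinh 2β` for some `K > 0`. Near `ν` the factor `sin 2α`
  -- has the sign of `e`, and `Im z = 2αβ` with `α > 0`, so `-e Im τ` has the sign of `Im z`.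
  refine ⟨-e, neg_ne_zero.2 hene, ?_⟩
  have hcont : ContinuousAt omega ν := Complex.continuousAt_sqrt (Or.inl (by simpa using hν0.le))
  have hcont2 : ContinuousAt (fun z => e * Real.sin (2 * (omega z).re)) ν := by
    have : ContinuousAt (fun z => (omega z).re) ν :=
      Complex.continuous_re.continuousAt.comp hcont
    exact (Real.continuous_sin.continuousAt.comp (this.const_mul 2)).const_mul e
  have hpos : ∀ᶠ z in 𝓝 (ν : ℂ), 0 < e * Real.sin (2 * (omega z).re) := by
    apply hcont2.eventually (p := fun x : ℝ => 0 < x)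
    apply lt_mem_nhds
    change 0 < e * Real.sin (2 * (omega ν).re)
    rw [hω, Complex.ofReal_re, ← he]
    exact mul_self_pos.2 hene
  filter_upwards [hpos, Complex.isOpen_slitPlane.mem_nhds hslit] with z hz hzs
  have hp := sqrt_pos hR hB
  have hα : 0 < (omega z).re := csqrt_re_pos hzs
  have him : (normTrace δR δB z).im = -((δR + 1) * (δB + 1) / (2 * √((δR : ℝ) * δB)) *
      (Real.sin (2 * (omega z).re) * Real.sinh (2 * (omega z).im))) := by
    have h2 : normTrace δR δB z = (((δR + 1) * (δB + 1) / (2 * √((δR : ℝ) * δB)) : ℝ) : ℂ) *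
        Complex.cos (2 * omega z) + ((((δR + 1) * (δB + 1) / 2 - (δR + δB)) /
          √((δR : ℝ) * δB) : ℝ) : ℂ) := by
      have := sqrt_ne_zero hR hB
      rw [normTrace_eq hR hB, c_sq]
      push_cast
      field_simp
      ring
    have hre : (2 * omega z).re = 2 * (omega z).re := by simp
    have hi : (2 * omega z).im = 2 * (omega z).im := by simp
    rw [h2, Complex.add_im, Complex.im_ofReal_mul, Complex.ofReal_im, im_cos, hre, hi]
    ring
  have hzim : z.im = 2 * (omega z).re * (omega z).im := by
    conv_lhs => rw [← omega_sq z, pow_two, Complex.mul_im]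
    ring
  set K : ℝ := (δR + 1) * (δB + 1) / (2 * √((δR : ℝ) * δB)) with hK
  have hKpos : 0 < K := by positivity
  have hform : -e * (normTrace δR δB z).im =
      K * (e * Real.sin (2 * (omega z).re)) * Real.sinh (2 * (omega z).im) := by
    rw [him]; ring
  rw [hform]
  have hc : 0 < K * (e * Real.sin (2 * (omega z).re)) := mul_pos hKpos hz
  constructor
  · intro h
    refine mul_pos hc (Real.sinh_pos_iff.2 ?_)
    rw [hzim] at h
    have := (pos_iff_pos_of_mul_pos h).1 (by positivity)
    linarith
  · intro h
    refine mul_neg_of_pos_of_neg hc (Real.sinh_neg_iff.2 ?_)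
    rw [hzim] at h
    have := neg_of_mul_neg_right h (by positivity)
    linarith

end

/-! ### Zeros of the discriminant -/

theorem c_ofReal_sq (w : ℝ) : c (((w ^ 2 : ℝ)) : ℂ) = (Real.cos w : ℂ) := by
  rw [c_eq_cos (w := (w : ℂ)) (by push_cast; rfl), Complex.ofReal_cos]

section

variable {δR δB : ℕ}

theorem exists_notMem_discZeros (hR : 1 ≤ δR) (hB : 1 ≤ δB) : ∃ z, z ∉ discZeros δR δB := by
  by_contra! hall
  have hpc := sqrt_ne_zero hR hB
  have key : ∀ w : ℝ, ((δR + 1) * (δB + 1) * Real.cos w ^ 2 - (δR + δB) : ℝ) ^ 2 =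
      4 * (√((δR : ℝ) * δB)) ^ 2 := by
    intro w
    have h := (mem_discZeros_iff hR hB).1 (hall (((w ^ 2 : ℝ)) : ℂ))
    rw [normTrace_eq hR hB, c_ofReal_sq, div_pow, div_eq_iff (pow_ne_zero 2 hpc)] at h
    exact_mod_cast h
  -- The test values make `cos²` equal to 1, 0 and 1/2. The first two force `A = 2S`, and then the
  -- third reads `0 = 4p²`.
  have h1 := key 0
  have h2 := key (Real.pi / 2)
  have h3 := key (Real.pi / 4)
  rw [Real.cos_zero] at h1
  rw [Real.cos_pi_div_two] at h2
  rw [Real.cos_pi_div_four, div_pow, Real.sq_sqrt (by norm_num)] at h3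
  have hp := sqrt_pos hR hB
  set p := √((δR : ℝ) * δB)
  have hA : (0 : ℝ) < (δR + 1) * (δB + 1) := by positivity
  set A : ℝ := (δR + 1) * (δB + 1)
  set S : ℝ := δR + δB
  have h4 : A * (A - 2 * S) = 0 := by linear_combination h1 - h2
  have h5 : A = 2 * S := by
    rcases mul_eq_zero.1 h4 with h | h
    · exact absurd h hA.ne'
    · linarith
  rw [h5] at h3
  nlinarith [pow_pos hp 2]

theorem isClosed_discZeros (hR : 1 ≤ δR) (hB : 1 ≤ δB) : IsClosed (discZeros δR δB) := by
  have h : discZeros δR δB = {z | normTrace δR δB z ^ 2 = 4} :=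
    Set.ext fun z => mem_discZeros_iff hR hB
  rw [h]
  exact isClosed_eq ((differentiable_normTrace hR hB).continuous.pow 2) continuous_const

/-- By the identity theorem, an accumulation point would make the entire function `τ² - 4` vanish
identically. -/
theorem discreteTopology_discZeros (hR : 1 ≤ δR) (hB : 1 ≤ δB) :
    DiscreteTopology (discZeros δR δB) := by
  rw [discreteTopology_subtype_iff]
  intro p _
  rw [← disjoint_iff, disjoint_principal_right]
  by_contra hn
  have hf : AnalyticOnNhd ℂ (fun z => normTrace δR δB z ^ 2 - 4) Set.univ :=
    Complex.analyticOnNhd_univ_iff_differentiable.2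
      (((differentiable_normTrace hR hB).pow 2).sub_const 4)
  have hz := hf.eqOn_zero_of_preconnected_of_frequently_eq_zero isPreconnected_univ
    (Set.mem_univ p) (by
      intro h
      apply hn
      filter_upwards [h] with z hz hzZ
      exact hz (sub_eq_zero.2 ((mem_discZeros_iff hR hB).1 hzZ)))
  obtain ⟨z, hzn⟩ := exists_notMem_discZeros hR hB
  exact hzn ((mem_discZeros_iff hR hB).2 (sub_eq_zero.1 (hz (Set.mem_univ z))))

/-! ### The two eigenvalue branches off `σ₁` -/

variable (δR δB) in
/-- The eigenvalue of larger modulus. -/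
noncomputable def eigPlus (z : ℂ) : ℂ :=
  outerRoot (normTrace δR δB z) / (√((δR : ℝ) * δB) : ℂ)

variable (δR δB) in
/-- The eigenvalue of smaller modulus. -/
noncomputable def eigMinus (z : ℂ) : ℂ :=
  innerRoot (normTrace δR δB z) / (√((δR : ℝ) * δB) : ℂ)

theorem analyticOnNhd_eigPlus (hR : 1 ≤ δR) (hB : 1 ≤ δB) :
    AnalyticOnNhd ℂ (eigPlus δR δB) (sigma1 δR δB)ᶜ := fun z hz =>
  (AnalyticAt.fun_comp (analyticAt_outerRoot (mt (mem_sigma1_iff hR hB).2 hz))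
    ((differentiable_normTrace hR hB).analyticAt z)).div_const

theorem analyticOnNhd_eigMinus (hR : 1 ≤ δR) (hB : 1 ≤ δB) :
    AnalyticOnNhd ℂ (eigMinus δR δB) (sigma1 δR δB)ᶜ := fun z hz =>
  (AnalyticAt.fun_comp (analyticAt_innerRoot (mt (mem_sigma1_iff hR hB).2 hz))
    ((differentiable_normTrace hR hB).analyticAt z)).div_const

theorem spectrum_T_eq_eig (hR : 1 ≤ δR) (hB : 1 ≤ δB) {z : ℂ} (hz : z ∉ sigma1 δR δB)
    (j : Fin 2) : spectrum ℂ (T δR δB j z) = {eigPlus δR δB z, eigMinus δR δB z} :=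
  spectrum_T hR hB j (outerRoot_add_innerRoot _)
    (outerRoot_mul_innerRoot (mt (mem_sigma1_iff hR hB).2 hz))

theorem norm_eigPlus_gt (hR : 1 ≤ δR) (hB : 1 ≤ δB) {z : ℂ} (hz : z ∉ sigma1 δR δB) :
    1 / √((δR : ℝ) * δB) < ‖eigPlus δR δB z‖ := by
  have hp := sqrt_pos hR hB
  have h := one_lt_norm_outerRoot (mt (mem_sigma1_iff hR hB).2 hz)
  rw [eigPlus, norm_div, Complex.norm_real, Real.norm_of_nonneg hp.le]
  gcongr

theorem norm_eigMinus_lt (hR : 1 ≤ δR) (hB : 1 ≤ δB) {z : ℂ} (hz : z ∉ sigma1 δR δB) :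
    ‖eigMinus δR δB z‖ < 1 / √((δR : ℝ) * δB) := by
  have hp := sqrt_pos hR hB
  have h := norm_innerRoot_lt_one (mt (mem_sigma1_iff hR hB).2 hz)
  rw [eigMinus, norm_div, Complex.norm_real, Real.norm_of_nonneg hp.le]
  gcongr

/-! ### Asymptotics along the negative real axis -/

theorem omega_ofReal_of_nonpos {t : ℝ} (ht : t ≤ 0) : omega (t : ℂ) = Complex.I * (√(-t) : ℝ) := by
  have h : 0 ≤ -t := by linarith
  have h2 := Complex.sqrt_neg_of_nonneg (Complex.zero_le_real.2 h)
  rw [Complex.sqrt_of_nonneg (Complex.zero_le_real.2 h), Complex.ofReal_re] at h2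
  rw [omega, ← h2]
  push_cast
  rw [neg_neg]

theorem abs_im_omega_of_nonpos {t : ℝ} (ht : t ≤ 0) : |(omega (t : ℂ)).im| = √(-t) := by
  rw [omega_ofReal_of_nonpos ht]
  simp

theorem c_sq_mul_exp_of_nonpos {t : ℝ} (ht : t ≤ 0) :
    (Real.exp (-2 * √(-t)) : ℂ) * c t ^ 2 = ((1 + (Real.exp (-2 * √(-t)) : ℂ)) / 2) ^ 2 := by
  have h1 : c t = (Real.cosh (√(-t)) : ℂ) := by
    rw [c, omega_ofReal_of_nonpos ht, mul_comm, Complex.cos_mul_I, Complex.ofReal_cosh]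
  have h2 : Real.exp (-2 * √(-t)) = Real.exp (-√(-t)) ^ 2 := by
    rw [← Real.exp_nat_mul]; congr 1; push_cast; ring
  have h3 : Real.exp (√(-t)) * Real.exp (-√(-t)) = 1 := by rw [← Real.exp_add]; simp
  rw [h1, h2, Real.cosh_eq]
  norm_cast
  set a := Real.exp (√(-t))
  set b := Real.exp (-√(-t))
  linear_combination ((b ^ 2 + 1) / 2 + (a * b - 1) / 4) * h3

theorem tendsto_exp_neg_atBot :
    Tendsto (fun t : ℝ => (Real.exp (-2 * √(-t)) : ℂ)) atBot (𝓝 0) := by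
  have h1 : Tendsto (fun t : ℝ => √(-t)) atBot atTop :=
    Real.tendsto_sqrt_atTop.comp tendsto_neg_atBot_atTop
  have h2 : Tendsto (fun t : ℝ => -2 * √(-t)) atBot atBot :=
    h1.const_mul_atTop_of_neg (by norm_num)
  have h3 := Real.tendsto_exp_atBot.comp h2
  have h4 := (Complex.continuous_ofReal.tendsto 0).comp h3
  rwa [Complex.ofReal_zero] at h4

theorem tendsto_exp_mul_normTrace (hR : 1 ≤ δR) (hB : 1 ≤ δB) :
    Tendsto (fun t : ℝ => (Real.exp (-2 * √(-t)) : ℂ) * normTrace δR δB t) atBot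
      (𝓝 (((δR : ℂ) + 1) * (δB + 1) / 4 / (√((δR : ℝ) * δB) : ℂ))) := by
  have h0 := tendsto_exp_neg_atBot
  have h1 := (((((h0.const_add 1).div_const 2).pow 2).const_mul (((δR : ℂ) + 1) * (δB + 1))).sub
    (h0.const_mul ((δR : ℂ) + δB))).div_const (√((δR : ℝ) * δB) : ℂ)
  have h2 : ((((δR : ℂ) + 1) * (δB + 1)) * ((1 + 0) / 2) ^ 2 - ((δR : ℂ) + δB) * 0) /
      (√((δR : ℝ) * δB) : ℂ) = ((δR : ℂ) + 1) * (δB + 1) / 4 / (√((δR : ℝ) * δB) : ℂ) := by ring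
  rw [h2] at h1
  refine h1.congr' ?_
  filter_upwards [eventually_le_atBot 0] with t ht
  rw [normTrace_eq hR hB, ← c_sq_mul_exp_of_nonpos ht]
  ring

/-- The trace grows exponentially, so `√(1 - 4/τ²) → 1` and the outer root is asymptotic to `τ`
itself. -/
theorem tendsto_exp_mul_outerRoot (hR : 1 ≤ δR) (hB : 1 ≤ δB) :
    Tendsto (fun t : ℝ => (Real.exp (-2 * √(-t)) : ℂ) * outerRoot (normTrace δR δB t)) atBot
      (𝓝 (((δR : ℂ) + 1) * (δB + 1) / 4 / (√((δR : ℝ) * δB) : ℂ))) := by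
  have h1 := tendsto_exp_mul_normTrace hR hB
  have hne : ((δR : ℂ) + 1) * (δB + 1) / 4 / (√((δR : ℝ) * δB) : ℂ) ≠ 0 := by
    have ha : (δR : ℂ) + 1 ≠ 0 := by exact_mod_cast Nat.succ_ne_zero δR
    have hb : (δB : ℂ) + 1 ≠ 0 := by exact_mod_cast Nat.succ_ne_zero δB
    exact div_ne_zero (div_ne_zero (mul_ne_zero ha hb) (by norm_num)) (sqrt_ne_zero hR hB)
  have h2 : Tendsto (fun t : ℝ => (normTrace δR δB t)⁻¹) atBot (𝓝 0) := by
    have h := tendsto_exp_neg_atBot.div h1 hne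
    rw [zero_div] at h
    refine h.congr fun t => ?_
    have he : (Real.exp (-2 * √(-t)) : ℂ) ≠ 0 := Complex.ofReal_ne_zero.2 (Real.exp_pos _).ne'
    simp only [Pi.div_apply]
    rw [div_mul_eq_div_div, div_self he, one_div]
  have h3 : Tendsto (fun t : ℝ => Complex.sqrt (1 - 4 / normTrace δR δB t ^ 2)) atBot (𝓝 1) := by
    have h4 : Tendsto (fun t : ℝ => 1 - 4 * (normTrace δR δB t)⁻¹ ^ 2) atBot (𝓝 1) := by
      have := ((h2.pow 2).const_mul 4).const_sub 1
      simpa using this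
    have h5 : ContinuousAt Complex.sqrt 1 := Complex.continuousAt_sqrt (Or.inl (by simp))
    have h6 := h5.tendsto.comp h4
    rw [Complex.sqrt_one] at h6
    refine h6.congr fun t => ?_
    simp only [Function.comp_apply, inv_pow, div_eq_mul_inv]
  have h7 := h1.mul ((h3.const_add 1).div_const 2)
  have h8 : ((1 : ℂ) + 1) / 2 = 1 := by norm_num
  rw [h8, mul_one] at h7
  refine h7.congr fun t => ?_
  rw [outerRoot]; ring

theorem tendsto_exp_mul_eigPlus (hR : 1 ≤ δR) (hB : 1 ≤ δB) :
    Tendsto (fun t : ℝ => (Real.exp (-2 * |(omega (t : ℂ)).im|) : ℂ) * eigPlus δR δB t) atBot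
      (𝓝 (((δR : ℂ) + 1) / (2 * δR) * (((δB : ℂ) + 1) / (2 * δB)))) := by
  have h := (tendsto_exp_mul_outerRoot hR hB).div_const (√((δR : ℝ) * δB) : ℂ)
  have h3 : ((δR : ℂ) + 1) * (δB + 1) / 4 / (√((δR : ℝ) * δB) : ℂ) / (√((δR : ℝ) * δB) : ℂ) =
      ((δR : ℂ) + 1) / (2 * δR) * (((δB : ℂ) + 1) / (2 * δB)) := by
    rw [div_div _ (√((δR : ℝ) * δB) : ℂ), ← pow_two, sqrt_sq_complex, div_mul_div_comm, div_div]
    congr 1; ring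
  rw [h3] at h
  refine h.congr' ?_
  filter_upwards [eventually_le_atBot 0] with t ht
  rw [abs_im_omega_of_nonpos ht, eigPlus]
  ring

/-- The inner root is the reciprocal of the outer one, so the limit is obtained by inversion. -/
theorem tendsto_exp_mul_eigMinus (hR : 1 ≤ δR) (hB : 1 ≤ δB) :
    Tendsto (fun t : ℝ => (Real.exp (2 * |(omega (t : ℂ)).im|) : ℂ) * eigMinus δR δB t) atBot
      (𝓝 (2 / ((δR : ℂ) + 1) * (2 / ((δB : ℂ) + 1)))) := by
  have hs := sqrt_ne_zero hR hB
  have ha : (δR : ℂ) + 1 ≠ 0 := by exact_mod_cast Nat.succ_ne_zero δR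
  have hb : (δB : ℂ) + 1 ≠ 0 := by exact_mod_cast Nat.succ_ne_zero δB
  have h := ((tendsto_exp_mul_outerRoot hR hB).inv₀
    (div_ne_zero (div_ne_zero (mul_ne_zero ha hb) (by norm_num)) hs)).div_const
    (√((δR : ℝ) * δB) : ℂ)
  have h3 : (((δR : ℂ) + 1) * (δB + 1) / 4 / (√((δR : ℝ) * δB) : ℂ))⁻¹ / (√((δR : ℝ) * δB) : ℂ) =
      2 / ((δR : ℂ) + 1) * (2 / ((δB : ℂ) + 1)) := by
    field_simp; norm_num
  rw [h3] at h
  refine h.congr' ?_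
  filter_upwards [eventually_lt_atBot 0] with t ht
  have hns : (t : ℂ) ∉ sigma1 δR δB := fun hm => by
    have := (sigma1_subset hR hB hm).1
    rw [Complex.ofReal_re] at this
    linarith
  have hm := outerRoot_mul_innerRoot (mt (mem_sigma1_iff hR hB).2 hns)
  rw [abs_im_omega_of_nonpos ht.le, eigMinus, mul_inv, ← eq_inv_of_mul_eq_one_right hm,
    ← Complex.ofReal_inv, ← Real.exp_neg, neg_mul, neg_neg]
  ring

/-! ### Extension to the real axis from either side -/

/-- Limits at all boundary points already give a continuous extension. Where a local analytic `g`
exists, it is continuous at all nearby boundary points too, so the extension coincides with `g`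
there. -/
theorem isBoundaryExtension_extendFrom {H E : Set ℂ} {f : ℂ → ℂ} (hH : IsOpen H)
    (hf : ContinuousOn f H)
    (hana : ∀ p ∈ frontier H, p ∉ E →
      ∃ g : ℂ → ℂ, AnalyticAt ℂ g p ∧ ∀ᶠ z in 𝓝 p, z ∈ H → f z = g z)
    (hlim : ∀ p ∈ frontier H, p ∈ E → ∃ y, Tendsto f (𝓝[H] p) (𝓝 y)) :
    IsBoundaryExtension H E f (extendFrom H f) where
  eqOn := fun z hz => extendFrom_extends hf z hz
  continuousOn := by
    apply continuousOn_extendFrom subset_rfl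
    intro p hp
    by_cases hpH : p ∈ H
    · exact ⟨f p, hf p hpH⟩
    have hfr : p ∈ frontier H := ⟨hp, by rwa [hH.interior_eq]⟩
    by_cases hpE : p ∈ E
    · exact hlim p hfr hpE
    · obtain ⟨g, hg, hfg⟩ := hana p hfr hpE
      refine ⟨g p, (hg.continuousAt.tendsto.mono_left nhdsWithin_le_nhds).congr' ?_⟩
      filter_upwards [nhdsWithin_le_nhds hfg, self_mem_nhdsWithin] with z h1 h2
      exact (h1 h2).symm
  analytic := by
    intro p hp hpE
    obtain ⟨g, hg, hfg⟩ := hana p hp hpE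
    refine ⟨g, hg, ?_⟩
    filter_upwards [hg.eventually_analyticAt, hfg.eventually_nhds] with z hz1 hz2 hz
    refine extendFrom_eq hz ((hz1.continuousAt.tendsto.mono_left nhdsWithin_le_nhds).congr' ?_)
    filter_upwards [nhdsWithin_le_nhds hz2, self_mem_nhdsWithin] with w h1 h2
    exact (h1 h2).symm

theorem IsBoundaryExtension.tendsto {H E : Set ℂ} {f F : ℂ → ℂ}
    (h : IsBoundaryExtension H E f F) {p : ℂ} (hp : p ∈ closure H) :
    Tendsto f (𝓝[H] p) (𝓝 (F p)) := by
  have h1 : Tendsto F (𝓝[H] p) (𝓝 (F p)) :=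
    (h.continuousOn p hp).mono_left (nhdsWithin_mono p subset_closure)
  refine h1.congr' ?_
  filter_upwards [self_mem_nhdsWithin] with z hz
  exact h.eqOn hz

theorem isOpen_upper : IsOpen upper := isOpen_lt continuous_const Complex.continuous_im

theorem isOpen_lower : IsOpen lower := isOpen_lt Complex.continuous_im continuous_const

theorem upper_subset (hR : 1 ≤ δR) (hB : 1 ≤ δB) : upper ⊆ (sigma1 δR δB)ᶜ :=
  fun _ hz hs => (ne_of_gt hz) (sigma1_subset hR hB hs).2

theorem lower_subset (hR : 1 ≤ δR) (hB : 1 ≤ δB) : lower ⊆ (sigma1 δR δB)ᶜ :=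
  fun _ hz hs => (ne_of_lt hz) (sigma1_subset hR hB hs).2

theorem ofReal_mem_closure_upper (x : ℝ) : (x : ℂ) ∈ closure upper := by
  rw [upper, Complex.closure_setOfPred_lt_im]
  simp

theorem ofReal_mem_closure_lower (x : ℝ) : (x : ℂ) ∈ closure lower := by
  rw [lower, Complex.closure_setOfPred_im_lt]
  simp

theorem exists_ofReal_of_mem_frontier_upper {p : ℂ} (hp : p ∈ frontier upper) :
    ∃ x : ℝ, p = x := by
  rw [upper, Complex.frontier_setOfPred_lt_im] at hp
  exact ⟨p.re, Complex.ext rfl hp⟩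

theorem exists_ofReal_of_mem_frontier_lower {p : ℂ} (hp : p ∈ frontier lower) :
    ∃ x : ℝ, p = x := by
  rw [lower, Complex.frontier_setOfPred_im_lt] at hp
  exact ⟨p.re, Complex.ext rfl hp⟩

/-- Near a point of `σ₁` where the discriminant does not vanish, the two eigenvalues are given by
two analytic functions, which are interchanged when the real axis is crossed. -/
theorem exists_analytic_branches (hR : 1 ≤ δR) (hB : 1 ≤ δB) {ν : ℝ}
    (hν : (ν : ℂ) ∈ sigma1 δR δB) (hZ : (ν : ℂ) ∉ discZeros δR δB) :
    ∃ g h : ℂ → ℂ, AnalyticAt ℂ g ν ∧ AnalyticAt ℂ h ν ∧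
      (∀ᶠ z in 𝓝 (ν : ℂ), z ∈ upper → eigPlus δR δB z = g z) ∧
      (∀ᶠ z in 𝓝 (ν : ℂ), z ∈ upper → eigMinus δR δB z = h z) ∧
      (∀ᶠ z in 𝓝 (ν : ℂ), z ∈ lower → eigPlus δR δB z = h z) ∧
      (∀ᶠ z in 𝓝 (ν : ℂ), z ∈ lower → eigMinus δR δB z = g z) := by
  obtain ⟨e, he, hev⟩ := im_normTrace_sign hR hB hν hZ
  obtain ⟨h1, h2⟩ := (mem_sigma1_iff hR hB).1 hν
  have h3 : |(normTrace δR δB ν).re| < 2 := by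
    refine lt_of_le_of_ne h2 fun h => hZ ((mem_discZeros_iff hR hB).2 ?_)
    have h4 : normTrace δR δB ν = ((normTrace δR δB ν).re : ℂ) :=
      Complex.ext rfl (by simpa using h1)
    rw [h4, ← Complex.ofReal_pow, ← sq_abs, h]
    norm_num
  have hτ := (differentiable_normTrace hR hB).analyticAt ν
  have hu : AnalyticAt ℂ (fun z => upperRoot (normTrace δR δB z) / (√((δR : ℝ) * δB) : ℂ)) ν :=
    (AnalyticAt.fun_comp (analyticAt_upperRoot (Or.inr h3)) hτ).div_const
  have hl : AnalyticAt ℂ (fun z => lowerRoot (normTrace δR δB z) / (√((δR : ℝ) * δB) : ℂ)) ν :=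
    (AnalyticAt.fun_comp (analyticAt_lowerRoot (Or.inr h3)) hτ).div_const
  -- The sign of `e` tells whether `τ` preserves or exchanges the half planes near `ν`, hence which
  -- root the outer one is on each side.
  rcases he.lt_or_gt with he | he
  · refine ⟨_, _, hl, hu, ?_, ?_, ?_, ?_⟩ <;> filter_upwards [hev] with z hz hzH
    · rw [eigPlus, (roots_of_im_neg (neg_of_mul_pos_right (hz.1 hzH) he.le)).1]
    · rw [eigMinus, (roots_of_im_neg (neg_of_mul_pos_right (hz.1 hzH) he.le)).2]
    · rw [eigPlus, (roots_of_im_pos (pos_of_mul_neg_right (hz.2 hzH) he.le)).1]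
    · rw [eigMinus, (roots_of_im_pos (pos_of_mul_neg_right (hz.2 hzH) he.le)).2]
  · refine ⟨_, _, hu, hl, ?_, ?_, ?_, ?_⟩ <;> filter_upwards [hev] with z hz hzH
    · rw [eigPlus, (roots_of_im_pos (pos_of_mul_pos_right (hz.1 hzH) he.le)).1]
    · rw [eigMinus, (roots_of_im_pos (pos_of_mul_pos_right (hz.1 hzH) he.le)).2]
    · rw [eigPlus, (roots_of_im_neg (neg_of_mul_neg_right (hz.2 hzH) he.le)).1]
    · rw [eigMinus, (roots_of_im_neg (neg_of_mul_neg_right (hz.2 hzH) he.le)).2]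

/-- At a zero of the discriminant both eigenvalues have the same limit. -/
theorem tendsto_eig_of_mem_discZeros (hR : 1 ≤ δR) (hB : 1 ≤ δB) {p : ℂ}
    (hp : p ∈ discZeros δR δB) :
    ∃ y, Tendsto (eigPlus δR δB) (𝓝[(sigma1 δR δB)ᶜ] p) (𝓝 y) ∧
      Tendsto (eigMinus δR δB) (𝓝[(sigma1 δR δB)ᶜ] p) (𝓝 y) := by
  have hp' := (mem_discZeros_iff hR hB).1 hp
  -- On `Z` the equation for `w` has the double root `e = ±1`, the common limit.
  set e := normTrace δR δB p / 2 with he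
  have he1 : e ^ 2 = 1 := by rw [he, div_pow, hp']; norm_num
  have ht : Tendsto (normTrace δR δB) (𝓝[(sigma1 δR δB)ᶜ] p) (𝓝 (2 * e)) := by
    rw [he, mul_div_cancel₀ _ (two_ne_zero)]
    exact (differentiable_normTrace hR hB).continuous.continuousAt.mono_left nhdsWithin_le_nhds
  refine ⟨e / (√((δR : ℝ) * δB) : ℂ), Tendsto.div_const (tendsto_root he1 ht ?_) _,
    Tendsto.div_const (tendsto_root he1 ht ?_) _⟩ <;>
  · filter_upwards [self_mem_nhdsWithin] with z hz
    have h1 := outerRoot_add_innerRoot (normTrace δR δB z)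
    have h2 := outerRoot_mul_innerRoot (mt (mem_sigma1_iff hR hB).2 hz)
    set t := normTrace δR δB z
    first
      | linear_combination outerRoot t * h1 - h2
      | linear_combination innerRoot t * h1 - h2

/-- Off `σ₁` the eigenvalues are themselves analytic; on `σ₁` outside `Z` the local branches serve;
at points of `Z` only a limit is needed. -/
theorem isBoundaryExtension_eig (hR : 1 ≤ δR) (hB : 1 ≤ δB) :
    IsBoundaryExtension upper (discZeros δR δB) (eigPlus δR δB)
      (extendFrom upper (eigPlus δR δB)) ∧
    IsBoundaryExtension upper (discZeros δR δB) (eigMinus δR δB)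
      (extendFrom upper (eigMinus δR δB)) ∧
    IsBoundaryExtension lower (discZeros δR δB) (eigPlus δR δB)
      (extendFrom lower (eigPlus δR δB)) ∧
    IsBoundaryExtension lower (discZeros δR δB) (eigMinus δR δB)
      (extendFrom lower (eigMinus δR δB)) := by
  have hP := analyticOnNhd_eigPlus hR hB
  have hM := analyticOnNhd_eigMinus hR hB
  have hU := upper_subset hR hB
  have hL := lower_subset hR hB
  refine ⟨isBoundaryExtension_extendFrom isOpen_upper (hP.continuousOn.mono hU) ?_ ?_,
    isBoundaryExtension_extendFrom isOpen_upper (hM.continuousOn.mono hU) ?_ ?_,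
    isBoundaryExtension_extendFrom isOpen_lower (hP.continuousOn.mono hL) ?_ ?_,
    isBoundaryExtension_extendFrom isOpen_lower (hM.continuousOn.mono hL) ?_ ?_⟩
  all_goals intro p hp hpZ
  · by_cases hps : p ∈ sigma1 δR δB
    · obtain ⟨x, rfl⟩ := exists_ofReal_of_mem_frontier_upper hp
      obtain ⟨g, h, hg, hh, h1, h2, h3, h4⟩ := exists_analytic_branches hR hB hps hpZ
      exact ⟨g, hg, h1⟩
    · exact ⟨_, hP p hps, Eventually.of_forall fun _ _ => rfl⟩
  · obtain ⟨y, h1, h2⟩ := tendsto_eig_of_mem_discZeros hR hB hpZ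
    exact ⟨y, h1.mono_left (nhdsWithin_mono p hU)⟩
  · by_cases hps : p ∈ sigma1 δR δB
    · obtain ⟨x, rfl⟩ := exists_ofReal_of_mem_frontier_upper hp
      obtain ⟨g, h, hg, hh, h1, h2, h3, h4⟩ := exists_analytic_branches hR hB hps hpZ
      exact ⟨h, hh, h2⟩
    · exact ⟨_, hM p hps, Eventually.of_forall fun _ _ => rfl⟩
  · obtain ⟨y, h1, h2⟩ := tendsto_eig_of_mem_discZeros hR hB hpZ
    exact ⟨y, h2.mono_left (nhdsWithin_mono p hU)⟩
  · by_cases hps : p ∈ sigma1 δR δB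
    · obtain ⟨x, rfl⟩ := exists_ofReal_of_mem_frontier_lower hp
      obtain ⟨g, h, hg, hh, h1, h2, h3, h4⟩ := exists_analytic_branches hR hB hps hpZ
      exact ⟨h, hh, h3⟩
    · exact ⟨_, hP p hps, Eventually.of_forall fun _ _ => rfl⟩
  · obtain ⟨y, h1, h2⟩ := tendsto_eig_of_mem_discZeros hR hB hpZ
    exact ⟨y, h1.mono_left (nhdsWithin_mono p hL)⟩
  · by_cases hps : p ∈ sigma1 δR δB
    · obtain ⟨x, rfl⟩ := exists_ofReal_of_mem_frontier_lower hp
      obtain ⟨g, h, hg, hh, h1, h2, h3, h4⟩ := exists_analytic_branches hR hB hps hpZ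
      exact ⟨g, hg, h4⟩
    · exact ⟨_, hM p hps, Eventually.of_forall fun _ _ => rfl⟩
  · obtain ⟨y, h1, h2⟩ := tendsto_eig_of_mem_discZeros hR hB hpZ
    exact ⟨y, h2.mono_left (nhdsWithin_mono p hL)⟩

/-! ### Boundary values and the jump across `σ₁` -/

/-- Boundary values of the eigenvalues are eigenvalues, and their product is the determinant. -/
theorem spectrum_T_of_isBoundaryExtension (hR : 1 ≤ δR) (hB : 1 ≤ δB) {H E : Set ℂ}
    {P M : ℂ → ℂ} (hH : H ⊆ (sigma1 δR δB)ᶜ) (hP : IsBoundaryExtension H E (eigPlus δR δB) P)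
    (hM : IsBoundaryExtension H E (eigMinus δR δB) M) {p : ℂ} (hp : p ∈ closure H)
    : (∀ j, spectrum ℂ (T δR δB j p) = {P p, M p}) ∧ P p * M p = 1 / ((δR : ℂ) * δB) := by
  have hs := sqrt_ne_zero hR hB
  have hne : (𝓝[H] p).NeBot := mem_closure_iff_nhdsWithin_neBot.1 hp
  have h1 := hP.tendsto hp
  have h2 := hM.tendsto hp
  have hτ : Tendsto (normTrace δR δB) (𝓝[H] p) (𝓝 (normTrace δR δB p)) :=
    (differentiable_normTrace hR hB).continuous.continuousAt.mono_left nhdsWithin_le_nhds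
  set r : ℂ := (√((δR : ℝ) * δB) : ℂ) with hr
  -- Sum and product of the rescaled eigenvalues, `τ` and 1, pass to the limit and determine the
  -- spectrum at `p`.
  have hsum : P p * r + M p * r = normTrace δR δB p := by
    refine tendsto_nhds_unique ((h1.mul_const r).add (h2.mul_const r)) (hτ.congr fun z => ?_)
    rw [eigPlus, eigMinus, ← hr, div_mul_cancel₀ _ hs, div_mul_cancel₀ _ hs,
      outerRoot_add_innerRoot]
  have hprod : P p * r * (M p * r) = 1 := by
    refine tendsto_nhds_unique ((h1.mul_const r).mul (h2.mul_const r))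
      (tendsto_const_nhds.congr' ?_)
    filter_upwards [self_mem_nhdsWithin] with z hz
    rw [eigPlus, eigMinus, ← hr, div_mul_cancel₀ _ hs, div_mul_cancel₀ _ hs,
      outerRoot_mul_innerRoot (mt (mem_sigma1_iff hR hB).2 (hH hz))]
  refine ⟨fun j => ?_, ?_⟩
  · have h := spectrum_T hR hB j hsum hprod
    rwa [← hr, mul_div_cancel_right₀ _ hs, mul_div_cancel_right₀ _ hs] at h
  · rw [← sqrt_sq_complex, eq_div_iff (pow_ne_zero 2 hs)]
    linear_combination hprod

/-- On `σ₁` two numbers which make up the spectrum of both transfer matrices, with the right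
product, are complex conjugates. -/
theorem eq_conj_of_mem_sigma1 (hR : 1 ≤ δR) (hB : 1 ≤ δB) {z a b : ℂ} (hz : z ∈ sigma1 δR δB)
    (h : ∀ j, spectrum ℂ (T δR δB j z) = {a, b}) (hab : a * b = 1 / ((δR : ℂ) * δB)) :
    b = starRingEnd ℂ a := by
  have ha : ‖a‖ = 1 / √((δR : ℝ) * δB) := hz 0 a (by rw [h]; simp)
  have h0 : a ≠ 0 := norm_pos_iff.1 (by rw [ha]; exact one_div_pos.2 (sqrt_pos hR hB))
  -- Both `a b` and `a ā = |a|²` equal `1 / (δR δB)`.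
  apply mul_left_cancel₀ h0
  rw [hab, Complex.mul_conj, Complex.normSq_eq_norm_sq, ha, div_pow, one_pow,
    Real.sq_sqrt (by positivity)]
  push_cast; rfl

end

theorem tendsto_vertical_upper (ν : ℝ) :
    Tendsto (fun ε : ℝ => (ν + Complex.I * ε : ℂ)) (𝓝[>] 0) (𝓝[upper] (ν : ℂ)) := by
  refine tendsto_nhdsWithin_iff.2 ⟨?_, ?_⟩
  · have h : Continuous fun ε : ℝ => (ν + Complex.I * ε : ℂ) := by fun_prop
    have := (h.tendsto 0).mono_left (nhdsWithin_le_nhds (s := Set.Ioi 0))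
    simpa using this
  · filter_upwards [self_mem_nhdsWithin] with ε hε
    simpa [upper] using hε

theorem tendsto_vertical_lower (ν : ℝ) :
    Tendsto (fun ε : ℝ => (ν - Complex.I * ε : ℂ)) (𝓝[>] 0) (𝓝[lower] (ν : ℂ)) := by
  refine tendsto_nhdsWithin_iff.2 ⟨?_, ?_⟩
  · have h : Continuous fun ε : ℝ => (ν - Complex.I * ε : ℂ) := by fun_prop
    have := (h.tendsto 0).mono_left (nhdsWithin_le_nhds (s := Set.Ioi 0))
    simpa using this
  · filter_upwards [self_mem_nhdsWithin] with ε hε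
    simpa [lower] using hε

theorem IsBoundaryExtension.eq_of_eventually {H E : Set ℂ} {f F g : ℂ → ℂ}
    (h : IsBoundaryExtension H E f F) {p : ℂ} (hp : p ∈ closure H) (hg : AnalyticAt ℂ g p)
    (hfg : ∀ᶠ z in 𝓝 p, z ∈ H → f z = g z) : F p = g p := by
  have : (𝓝[H] p).NeBot := mem_closure_iff_nhdsWithin_neBot.1 hp
  refine tendsto_nhds_unique (h.tendsto hp)
    ((hg.continuousAt.tendsto.mono_left nhdsWithin_le_nhds).congr' ?_)
  filter_upwards [nhdsWithin_le_nhds hfg, self_mem_nhdsWithin] with z h1 h2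
  exact (h1 h2).symm

theorem IsBoundaryExtension.eq_of_tendsto {H E A : Set ℂ} {f F : ℂ → ℂ}
    (h : IsBoundaryExtension H E f F) (hA : H ⊆ A) {p y : ℂ} (hp : p ∈ closure H)
    (hy : Tendsto f (𝓝[A] p) (𝓝 y)) : F p = y := by
  have : (𝓝[H] p).NeBot := mem_closure_iff_nhdsWithin_neBot.1 hp
  exact tendsto_nhds_unique (h.tendsto hp) (hy.mono_left (nhdsWithin_mono p hA))

/-- The boundary values from above and from below are interchanged on `σ₁`. -/
theorem boundary_values_interchanged {δR δB : ℕ} (hR : 1 ≤ δR) (hB : 1 ≤ δB)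
    {Up Um Lp Lm : ℂ → ℂ}
    (hUp : IsBoundaryExtension upper (discZeros δR δB) (eigPlus δR δB) Up)
    (hUm : IsBoundaryExtension upper (discZeros δR δB) (eigMinus δR δB) Um)
    (hLp : IsBoundaryExtension lower (discZeros δR δB) (eigPlus δR δB) Lp)
    (hLm : IsBoundaryExtension lower (discZeros δR δB) (eigMinus δR δB) Lm)
    {ν : ℝ} (hν : (ν : ℂ) ∈ sigma1 δR δB) : Lp ν = Um ν ∧ Lm ν = Up ν := by
  have hu := ofReal_mem_closure_upper ν
  have hl := ofReal_mem_closure_lower ν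
  by_cases hZ : (ν : ℂ) ∈ discZeros δR δB
  · obtain ⟨y, h1, h2⟩ := tendsto_eig_of_mem_discZeros hR hB hZ
    have hU := upper_subset hR hB
    have hL := lower_subset hR hB
    exact ⟨(hLp.eq_of_tendsto hL hl h1).trans (hUm.eq_of_tendsto hU hu h2).symm,
      (hLm.eq_of_tendsto hL hl h2).trans (hUp.eq_of_tendsto hU hu h1).symm⟩
  · obtain ⟨g, h, hg, hh, h1, h2, h3, h4⟩ := exists_analytic_branches hR hB hν hZ
    exact ⟨(hLp.eq_of_eventually hl hh h3).trans (hUm.eq_of_eventually hu hh h2).symm,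
      (hLm.eq_of_eventually hl hg h4).trans (hUp.eq_of_eventually hu hg h1).symm⟩

end BiregularTree

open BiregularTree in
theorem theorem4p3 (δR δB : ℕ) (hR : 1 ≤ δR) (hB : 1 ≤ δB) :
    sigma1 δR δB ⊆ {z : ℂ | 0 ≤ z.re ∧ z.im = 0} ∧
    IsClosed (discZeros δR δB) ∧ DiscreteTopology (discZeros δR δB) ∧
    ∃ μp μm : ℂ → ℂ,
      -- eigenvalues of both transfer matrices, analytic off `σ₁`, separated by modulus
      (∀ z ∉ sigma1 δR δB, ∀ j : Fin 2, spectrum ℂ (T δR δB j z) = {μp z, μm z}) ∧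
      AnalyticOnNhd ℂ μp (sigma1 δR δB)ᶜ ∧ AnalyticOnNhd ℂ μm (sigma1 δR δB)ᶜ ∧
      (∀ z ∉ sigma1 δR δB,
        1 / √((δR : ℝ) * δB) < ‖μp z‖ ∧ ‖μm z‖ < 1 / √((δR : ℝ) * δB)) ∧
      -- asymptotics along the negative real axis
      Tendsto (fun t : ℝ => (Real.exp (-2 * |(omega (t : ℂ)).im|) : ℂ) * μp (t : ℂ)) atBot
        (𝓝 (((δR : ℂ) + 1) / (2 * δR) * (((δB : ℂ) + 1) / (2 * δB)))) ∧
      Tendsto (fun t : ℝ => (Real.exp (2 * |(omega (t : ℂ)).im|) : ℂ) * μm (t : ℂ)) atBot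
        (𝓝 (2 / ((δR : ℂ) + 1) * (2 / ((δB : ℂ) + 1)))) ∧
      -- extensions to the real axis from above (`Up`, `Um`) and from below (`Lp`, `Lm`)
      ∃ Up Um Lp Lm : ℂ → ℂ,
        IsBoundaryExtension upper (discZeros δR δB) μp Up ∧
        IsBoundaryExtension upper (discZeros δR δB) μm Um ∧
        IsBoundaryExtension lower (discZeros δR δB) μp Lp ∧
        IsBoundaryExtension lower (discZeros δR δB) μm Lm ∧
        -- the boundary values are the eigenvalues on the real axis
        (∀ x : ℝ, ∀ j : Fin 2, spectrum ℂ (T δR δB j x) = {Up x, Um x} ∧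
          spectrum ℂ (T δR δB j x) = {Lp x, Lm x}) ∧
        -- the jump across `σ₁`, and the interchange of the two sheets
        (∀ ν : ℝ, (ν : ℂ) ∈ sigma1 δR δB →
          Tendsto (fun ε : ℝ => μp (ν + Complex.I * ε) - μp (ν - Complex.I * ε)) (𝓝[>] 0)
            (𝓝 (2 * Complex.I * ((Up ν).im : ℂ))) ∧
          Tendsto (fun ε : ℝ => μm (ν + Complex.I * ε) - μm (ν - Complex.I * ε)) (𝓝[>] 0)
            (𝓝 (2 * Complex.I * ((Um ν).im : ℂ))) ∧
          Lp ν = Um ν ∧ Lm ν = Up ν ∧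
          ((ν : ℂ) ∉ discZeros δR δB →
            ContinuesAcross μp μm ν ∧ ContinuesAcross μm μp ν)) := by
  obtain ⟨hUp, hUm, hLp, hLm⟩ := isBoundaryExtension_eig hR hB
  have hU := upper_subset hR hB
  have hL := lower_subset hR hB
  refine ⟨sigma1_subset hR hB, isClosed_discZeros hR hB, discreteTopology_discZeros hR hB,
    eigPlus δR δB, eigMinus δR δB, fun z hz j => spectrum_T_eq_eig hR hB hz j,
    analyticOnNhd_eigPlus hR hB, analyticOnNhd_eigMinus hR hB,
    fun z hz => ⟨norm_eigPlus_gt hR hB hz, norm_eigMinus_lt hR hB hz⟩,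
    tendsto_exp_mul_eigPlus hR hB, tendsto_exp_mul_eigMinus hR hB,
    _, _, _, _, hUp, hUm, hLp, hLm, fun x j => ⟨?_, ?_⟩, fun ν hν => ?_⟩
  · exact (spectrum_T_of_isBoundaryExtension hR hB hU hUp hUm (ofReal_mem_closure_upper x)).1 j
  · exact (spectrum_T_of_isBoundaryExtension hR hB hL hLp hLm (ofReal_mem_closure_lower x)).1 j
  obtain ⟨hpm, hmp⟩ := boundary_values_interchanged hR hB hUp hUm hLp hLm hν
  obtain ⟨hspec, hprod⟩ :=
    spectrum_T_of_isBoundaryExtension hR hB hU hUp hUm (ofReal_mem_closure_upper ν)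
  have hconj := eq_conj_of_mem_sigma1 hR hB hν hspec hprod
  refine ⟨?_, ?_, hpm, hmp, fun hZ => ?_⟩
  · have h := ((hUp.tendsto (ofReal_mem_closure_upper ν)).comp (tendsto_vertical_upper ν)).sub
      ((hLp.tendsto (ofReal_mem_closure_lower ν)).comp (tendsto_vertical_lower ν))
    -- The value from below is the other eigenvalue from above, which is the conjugate; the
    -- difference is `2i` times the imaginary part.
    rw [hpm, hconj, Complex.sub_conj] at h
    rw [Complex.ofReal_mul, Complex.ofReal_ofNat, mul_right_comm] at h
    exact h
  · have h := ((hUm.tendsto (ofReal_mem_closure_upper ν)).comp (tendsto_vertical_upper ν)).sub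
      ((hLm.tendsto (ofReal_mem_closure_lower ν)).comp (tendsto_vertical_lower ν))
    have hconj' := congrArg (starRingEnd ℂ) hconj
    rw [Complex.conj_conj] at hconj'
    rw [hmp, ← hconj', Complex.sub_conj] at h
    rw [Complex.ofReal_mul, Complex.ofReal_ofNat, mul_right_comm] at h
    exact h
  · obtain ⟨g, h, hg, hh, h1, h2, h3, h4⟩ := exists_analytic_branches hR hB hν hZ
    exact ⟨⟨g, hg, h1, h4⟩, ⟨h, hh, h2, h3⟩⟩
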